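/- Let $G$ be a finitely generated group that fits in an exact sequence \[ 1\to N\to G\xrightarrow{\ \varphi\ }\mathbb{Z}\to 1, \] and identify $N$ with its image in $G$. Let $F$ be a finite normal subgroup of $N$. Let $\mu$ be a symmetric probability measure on $G$ (that is, $\mu(g^{-1})=\mu(g)$ for all $g\in G$) whose support is finite and generates $G$, and assume that the projection $\varphi_*\mu$ of $\mu$ to $\mathbb{Z}$ is the step law of simple random walk, i.e. it gives mass $\tfrac12$ to each of $1$ and $-1$. Let $\pi:G\to\mathcal{U}(\mathcal{H})$ be a unitary representation on a complex Hilbert space $\mathcal{H}$ that is weakly mixing, i.e. has no nonzero finite-dimensional invariant subspace. Let $b:G\to\mathcal{H}$ be a $\mu$-harmonic $1$-cocycle with linear part $\pi$, i.e. \[ b(gh)=b(g)+\pi_g b(h)\quad\text{for all } g,h\in G, \qquad \sum_{g\in G} b(xg)\,\mu(g)=b(x)\quad\text{for all } x\in G . \] Then $b(\gamma)=0$ for all $\gamma\in F$. -/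

import Mathlib

/-- The step law of simple random walk on `ℤ`: the uniform law on `{1, -1}`. -/
noncomputable def simpleRandomWalkLaw : PMF ℤ :=
  PMF.uniformOfFinset {1, -1} (Finset.insert_nonempty 1 {-1})

/-- A probability measure on the group `G`, given by its mass function, is symmetric. -/
def IsSymmetricLaw {G : Type*} [Group G] (μ : PMF G) : Prop :=
  ∀ g : G, μ g⁻¹ = μ g

/-- The support of `μ` is finite and generates the group `G`. -/
def HasFiniteGeneratingSupport {G : Type*} [Group G] (μ : PMF G) : Prop :=
  μ.support.Finite ∧ Subgroup.closure μ.support = ⊤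

/-- The unitary representation `π` has no nonzero finite-dimensional invariant subspace. -/
def IsWeaklyMixingRep {G H : Type*} [Group G] [NormedAddCommGroup H] [InnerProductSpace ℂ H]
    [CompleteSpace H] (π : G →* unitary (H →L[ℂ] H)) : Prop :=
  ∀ V : Submodule ℂ H, FiniteDimensional ℂ V →
    (∀ g : G, ∀ v ∈ V, (π g : H →L[ℂ] H) v ∈ V) → V = ⊥

/-- `b` is a 1-cocycle with linear part `π`. -/
def IsOneCocycle {G H : Type*} [Group G] [NormedAddCommGroup H] [InnerProductSpace ℂ H]
    [CompleteSpace H] (π : G →* unitary (H →L[ℂ] H)) (b : G → H) : Prop :=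
  ∀ g h : G, b (g * h) = b g + (π g : H →L[ℂ] H) (b h)

/-- `b` is `μ`-harmonic: `∑ g, μ(g) b(xg) = b(x)` for every `x`. -/
def IsHarmonicFor {G H : Type*} [Group G] [NormedAddCommGroup H] [InnerProductSpace ℂ H]
    (μ : PMF G) (b : G → H) : Prop :=
  ∀ x : G, HasSum (fun g : G => (((μ g).toReal : ℝ) : ℂ) • b (x * g)) (b x)

/-!
The walk with step law `μ` is compared with its projection to `ℤ`, the simple random walk, which
returns to level zero. Let `ξ` be the mean of `b` over the finite group `F`. Then
`b γ = ξ - π γ ξ` on `F`, so it is enough that `ξ` is fixed by `N`. On all of `N`, which normalizes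
`F`, the function `h g = Re ⟪ξ, b g⟫` equals `‖ξ - π g ξ‖ ^ 2 / 2` (`exists_coboundary_vector`).
Thus `h` is a harmonic function on `G` that is nonnegative on level zero, with `h 1 = 0`.

Stop the walk started at `1` when it first returns to level zero or reaches the levels `±n`, and in
any case at time `n ^ 2`. By optional stopping the mean of `h` at that time is `0`. The expected
stopping time is at most `n`, and the walk stops away from level zero only with probability at most
`2 / n` (`integ_green_one_le`, `integ_stopped_level_ne_zero_le`). By the Cauchy-Schwarz inequality
the contribution of nonzero levels is at most the square root of `2 / n` times the second moment of
`h`. That moment is the energy `∑ s, μ s |⟪ξ, π g (b s)⟫| ^ 2` summed along the stopped path, and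
weak mixing makes it `o(n)` (`tendsto_integ_norm_inner_sq`). So the contribution of level zero,
where `h` is nonnegative, tends to `0`, and `h` vanishes at every first return point
(`harmonic_eq_zero_of_first_return`). These points generate `N`, and hence `N` fixes `ξ`.

For the `o(n)` bound, the Green measure of the stopped walk has mass at most `n` and is invariant
under convolution with `μ` up to an error of total mass `2`. A weak limit `Ψ` of the averages of
`π g⁻¹ v v* π g` against it, divided by `n`, is therefore a positive operator, harmonic under
conjugation, whose trace is at most `‖v‖ ^ 2` by Bessel's inequality. It is then compact
(`isCompactOperator_of_trace_le`), and its top eigenspace would be a finite-dimensional invariant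
subspace unless `Ψ = 0` (`eq_zero_of_harmonic`).

Measures on `G` are finitely supported functions `G →₀ ℝ`, so that all expectations are finite sums.
-/

open scoped InnerProductSpace
open Filter Topology

/-! ### Finitely supported measures on a group -/

/-- The integral of `f` against the finitely supported signed measure `p`. -/
noncomputable def integ {G E : Type*} [AddCommGroup E] [Module ℝ E] (p : G →₀ ℝ) (f : G → E) : E :=
  p.sum fun g r => r • f g

/-- The convolution of two finitely supported measures on a group. -/
noncomputable def convolve {G : Type*} [Group G] (p m : G →₀ ℝ) : G →₀ ℝ :=
  p.sum fun g r => m.sum fun s w => Finsupp.single (g * s) (r * w)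

section Integ

variable {G E E' : Type*} [AddCommGroup E] [Module ℝ E] [AddCommGroup E'] [Module ℝ E']

theorem integ_eq_sum (p : G →₀ ℝ) (f : G → E) : integ p f = ∑ g ∈ p.support, p g • f g := rfl

theorem integ_eq_linearCombination (p : G →₀ ℝ) (f : G → E) :
    integ p f = Finsupp.linearCombination ℝ f p := rfl

@[simp]
theorem integ_add_left (p q : G →₀ ℝ) (f : G → E) : integ (p + q) f = integ p f + integ q f := by
  simp [integ_eq_linearCombination]

theorem integ_sum_left {ι : Type*} (s : Finset ι) (p : ι → G →₀ ℝ) (f : G → E) :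
    integ (∑ i ∈ s, p i) f = ∑ i ∈ s, integ (p i) f := by
  simp [integ_eq_linearCombination]

@[simp]
theorem integ_single (g : G) (r : ℝ) (f : G → E) : integ (Finsupp.single g r) f = r • f g := by
  simp [integ_eq_linearCombination]

theorem integ_add (p : G →₀ ℝ) (f f' : G → E) :
    integ p (fun g => f g + f' g) = integ p f + integ p f' := by
  simp [integ_eq_sum, Finset.sum_add_distrib]

theorem integ_sub (p : G →₀ ℝ) (f f' : G → E) :
    integ p (fun g => f g - f' g) = integ p f - integ p f' := by
  simp [integ_eq_sum, smul_sub, Finset.sum_sub_distrib]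

theorem integ_map (L : E →ₗ[ℝ] E') (p : G →₀ ℝ) (f : G → E) :
    integ p (fun g => L (f g)) = L (integ p f) := by
  simp [integ_eq_sum]

@[simp]
theorem integ_const_zero (p : G →₀ ℝ) : integ p (fun _ => (0 : E)) = 0 := by
  simp [integ_eq_sum]

theorem integ_const_mul (p : G →₀ ℝ) (r : ℝ) (f : G → ℝ) :
    integ p (fun g => r * f g) = r * integ p f :=
  integ_map (LinearMap.mulLeft ℝ r) p f

theorem integ_const {p : G →₀ ℝ} (hp1 : integ p (fun _ => (1 : ℝ)) = 1) (r : ℝ) :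
    integ p (fun _ => r) = r := by
  have := integ_const_mul p r (fun _ => (1 : ℝ))
  rwa [hp1, mul_one] at this

theorem integ_finset_sum {ι : Type*} (s : Finset ι) (p : G →₀ ℝ) (f : ι → G → E) :
    integ p (fun g => ∑ i ∈ s, f i g) = ∑ i ∈ s, integ p (f i) := by
  simp only [integ_eq_sum, Finset.smul_sum]
  exact Finset.sum_comm

theorem integ_congr {p : G →₀ ℝ} {f f' : G → E} (h : ∀ g, p g ≠ 0 → f g = f' g) :
    integ p f = integ p f' := by
  simp only [integ_eq_sum]
  exact Finset.sum_congr rfl fun g hg => by rw [h g (Finsupp.mem_support_iff.1 hg)]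

theorem integ_mono {p : G →₀ ℝ} (hp : 0 ≤ p) {f f' : G → ℝ} (h : ∀ g, p g ≠ 0 → f g ≤ f' g) :
    integ p f ≤ integ p f' :=
  Finset.sum_le_sum fun g hg =>
    mul_le_mul_of_nonneg_left (h g (Finsupp.mem_support_iff.1 hg)) (hp g)

theorem integ_nonneg {p : G →₀ ℝ} (hp : 0 ≤ p) {f : G → ℝ} (h : ∀ g, p g ≠ 0 → 0 ≤ f g) :
    0 ≤ integ p f :=
  Finset.sum_nonneg fun g hg => mul_nonneg (hp g) (h g (Finsupp.mem_support_iff.1 hg))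

theorem mul_le_integ {p : G →₀ ℝ} (hp : 0 ≤ p) {f : G → ℝ} (h : ∀ g, p g ≠ 0 → 0 ≤ f g)
    (g : G) : p g * f g ≤ integ p f := by
  by_cases hg : p g = 0
  · simpa [hg] using integ_nonneg hp h
  · exact Finset.single_le_sum (f := fun g => p g • f g)
      (fun x hx => mul_nonneg (hp x) (h x (Finsupp.mem_support_iff.1 hx)))
      (Finsupp.mem_support_iff.2 hg)

theorem norm_integ_le {V : Type*} [NormedAddCommGroup V] [NormedSpace ℝ V] {p : G →₀ ℝ}
    (hp : 0 ≤ p) {f : G → V} {C : ℝ} (h : ∀ g, ‖f g‖ ≤ C) :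
    ‖integ p f‖ ≤ C * integ p (fun _ => (1 : ℝ)) := by
  rw [integ_eq_sum, integ_eq_sum, Finset.mul_sum]
  refine (norm_sum_le _ _).trans (Finset.sum_le_sum fun g _ => ?_)
  rw [norm_smul, Real.norm_of_nonneg (hp g), smul_eq_mul, mul_one, mul_comm]
  exact mul_le_mul_of_nonneg_right (h g) (hp g)

theorem integ_mul_sq_le {p : G →₀ ℝ} (hp : 0 ≤ p) (f f' : G → ℝ) :
    integ p (fun g => f g * f' g) ^ 2 ≤
      integ p (fun g => f g ^ 2) * integ p (fun g => f' g ^ 2) := by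
  refine Finset.sum_sq_le_sum_mul_sum_of_sq_le_mul _ (fun g _ => ?_) (fun g _ => ?_)
    (fun g _ => ?_)
  · exact mul_nonneg (hp g) (sq_nonneg _)
  · exact mul_nonneg (hp g) (sq_nonneg _)
  · simp only [smul_eq_mul]
    exact le_of_eq (by ring)

theorem integ_filter (p : G →₀ ℝ) (D : G → Prop) [DecidablePred D] (f : G → E) :
    integ (p.filter D) f = integ p (fun g => if D g then f g else 0) := by
  classical
  simp only [integ_eq_sum, Finsupp.support_filter, Finset.sum_filter, Finsupp.filter_apply]
  exact Finset.sum_congr rfl fun g _ => by split_ifs <;> simp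

theorem filter_nonneg {p : G →₀ ℝ} (hp : 0 ≤ p) (D : G → Prop) [DecidablePred D] :
    0 ≤ p.filter D := fun g => by
  rw [Finsupp.filter_apply]
  split_ifs
  · exact hp g
  · exact le_rfl

end Integ

section Conv

variable {G E : Type*} [Group G] [AddCommGroup E] [Module ℝ E]

theorem integ_conv (p m : G →₀ ℝ) (f : G → E) :
    integ (convolve p m) f = integ p (fun g => integ m (fun s => f (g * s))) := by
  simp only [integ_eq_linearCombination, convolve, Finsupp.sum, map_sum,
    Finsupp.linearCombination_single]
  simp [Finsupp.linearCombination_apply, Finsupp.sum, Finset.smul_sum, smul_smul]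

theorem conv_apply (p m : G →₀ ℝ) (x : G) [DecidableEq G] :
    convolve p m x = integ p (fun g => integ m (fun s => if g * s = x then (1 : ℝ) else 0)) := by
  rw [← integ_conv p m fun y => if y = x then (1 : ℝ) else 0, integ_eq_sum]
  simp

theorem conv_add_left (p q m : G →₀ ℝ) : convolve (p + q) m = convolve p m + convolve q m := by
  classical
  ext x
  simp [conv_apply]

theorem conv_nonneg {p m : G →₀ ℝ} (hp : 0 ≤ p) (hm : 0 ≤ m) : 0 ≤ convolve p m := by
  classical
  intro x
  rw [conv_apply]
  exact integ_nonneg hp fun g _ => integ_nonneg hm fun s _ => by split_ifs <;> simp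

theorem mul_le_conv {p m : G →₀ ℝ} (hp : 0 ≤ p) (hm : 0 ≤ m) (g s : G) :
    p g * m s ≤ convolve p m (g * s) := by
  classical
  rw [conv_apply]
  have h1 : ∀ x, 0 ≤ integ m (fun t => if x * t = g * s then (1 : ℝ) else 0) := fun x =>
    integ_nonneg hm fun s _ => by split_ifs <;> simp
  refine le_trans ?_ (mul_le_integ hp (fun x _ => h1 x) g)
  refine mul_le_mul_of_nonneg_left ?_ (hp g)
  simpa using mul_le_integ hm (f := fun t => if g * t = g * s then (1 : ℝ) else 0)
    (fun t _ => by split_ifs <;> simp) s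

theorem exists_of_conv_ne_zero {p m : G →₀ ℝ} {x : G} (h : convolve p m x ≠ 0) :
    ∃ g s, p g ≠ 0 ∧ m s ≠ 0 ∧ g * s = x := by
  classical
  by_contra! H
  apply h
  rw [conv_apply, integ_eq_sum]
  refine Finset.sum_eq_zero fun g hg => ?_
  rw [integ_eq_sum, Finset.sum_eq_zero, smul_zero]
  intro s hs
  rw [if_neg (H g s (Finsupp.mem_support_iff.1 hg) (Finsupp.mem_support_iff.1 hs)), smul_zero]

end Conv

/-! ### The random walk stopped on leaving a set -/

section Walk

variable {G : Type*} [Group G]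

open scoped Classical in
/-- The law at time `t` of the random walk from `1` with step law `m`, killed when it is outside `D`
at a positive time. The starting point `1` need not lie in `D`. -/
noncomputable def killed (m : G →₀ ℝ) (D : G → Prop) : ℕ → G →₀ ℝ
  | 0 => Finsupp.single 1 1
  | t + 1 => (convolve (killed m D t) m).filter D

/-- The Green measure up to time `T`: the expected number of visits of the killed walk. -/
noncomputable def green (m : G →₀ ℝ) (D : G → Prop) (T : ℕ) : G →₀ ℝ :=
  ∑ t ∈ Finset.range T, killed m D t

open scoped Classical in
/-- The law of the walk stopped at time `T`, or at its first positive time outside `D` if that is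
earlier. -/
noncomputable def stopped (m : G →₀ ℝ) (D : G → Prop) (T : ℕ) : G →₀ ℝ :=
  ∑ t ∈ Finset.range T, (convolve (killed m D t) m).filter (fun g => ¬ D g) + killed m D T

variable {m : G →₀ ℝ} {D : G → Prop}

theorem killed_nonneg (hm : 0 ≤ m) (t : ℕ) : 0 ≤ killed m D t := by
  classical
  induction t with
  | zero => exact Finsupp.single_nonneg.2 zero_le_one
  | succ t ih => exact filter_nonneg (conv_nonneg ih hm) _

theorem green_nonneg (hm : 0 ≤ m) (T : ℕ) : 0 ≤ green m D T :=
  Finset.sum_nonneg fun t _ => killed_nonneg hm t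

theorem stopped_nonneg (hm : 0 ≤ m) (T : ℕ) : 0 ≤ stopped m D T := by
  classical
  exact add_nonneg (Finset.sum_nonneg fun t _ => filter_nonneg (conv_nonneg (killed_nonneg hm t) hm)
    (fun g => ¬ D g)) (killed_nonneg hm T)

/-- Optional stopping, as an identity between measures. -/
theorem conv_green (T : ℕ) :
    convolve (green m D T) m + Finsupp.single 1 1 = green m D T + stopped m D T := by
  classical
  induction T with
  | zero => simp [green, stopped, killed, convolve]
  | succ T ih =>
    have h1 : green m D (T + 1) = green m D T + killed m D T := Finset.sum_range_succ _ _
    have h2 : stopped m D (T + 1) + killed m D T = stopped m D T + convolve (killed m D T) m := by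
      conv_rhs => rw [← Finsupp.filter_add_filter_not (convolve (killed m D T) m) D]
      simp only [stopped, Finset.sum_range_succ, killed]
      abel
    rw [h1, conv_add_left, add_right_comm, ih, add_assoc, add_assoc, ← h2]
    abel

/-- Optional stopping (Dynkin's formula). -/
theorem integ_stopped {E : Type*} [AddCommGroup E] [Module ℝ E] (T : ℕ) (f : G → E) :
    integ (stopped m D T) f =
      f 1 + integ (green m D T) (fun g => integ m (fun s => f (g * s)) - f g) := by
  have h := congrArg (fun p => integ p f) (conv_green (m := m) (D := D) T)
  simp only [integ_add_left, integ_conv, integ_single, one_smul] at h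
  rw [integ_sub, eq_comm, ← sub_eq_zero, ← sub_eq_zero.2 h]
  abel

theorem integ_stopped_one (hm1 : integ m (fun _ => (1 : ℝ)) = 1) (T : ℕ) :
    integ (stopped m D T) (fun _ => (1 : ℝ)) = 1 := by
  rw [integ_stopped, hm1]
  simp [integ_eq_sum]

theorem mem_of_killed_succ_ne_zero {t : ℕ} {g : G} (h : killed m D (t + 1) g ≠ 0) : D g := by
  classical
  by_contra hg
  exact h (Finsupp.filter_apply_neg _ _ hg)

theorem integ_killed_succ_le (hm : 0 ≤ m) (hm1 : integ m (fun _ => (1 : ℝ)) = 1) (t : ℕ) :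
    integ (killed m D (t + 1)) (fun _ => (1 : ℝ)) ≤ integ (killed m D t) (fun _ => (1 : ℝ)) := by
  classical
  have h : integ (convolve (killed m D t) m) (fun _ => (1 : ℝ)) =
      integ (killed m D t) (fun _ => (1 : ℝ)) := by rw [integ_conv, hm1]
  rw [← h, killed, integ_filter]
  exact integ_mono (conv_nonneg (killed_nonneg hm t) hm) fun g _ => by split_ifs <;> simp

theorem mul_integ_killed_le (hm : 0 ≤ m) (hm1 : integ m (fun _ => (1 : ℝ)) = 1) (T : ℕ) :
    T * integ (killed m D T) (fun _ => (1 : ℝ)) ≤ integ (green m D T) (fun _ => (1 : ℝ)) := by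
  have h := antitone_nat_of_succ_le
    (f := fun t => integ (killed m D t) (fun _ => (1 : ℝ))) (integ_killed_succ_le (D := D) hm hm1)
  rw [green, integ_sum_left]
  simpa using Finset.card_nsmul_le_sum (Finset.range T) _ _
    (fun t ht => h (Finset.mem_range.1 ht).le)

/-- The killed walk follows a given path inside `D` with at least the probability of its steps. -/
theorem prod_le_killed (hm : 0 ≤ m) (l : List G)
    (hl : ∀ l', l' <+: l → l' ≠ [] → D l'.prod) :
    (l.map m).prod ≤ killed m D l.length l.prod := by
  classical
  induction l using List.reverseRecOn with
  | nil => simp [killed]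
  | append_singleton l s ih =>
    have h1 := ih fun l' h => hl l' (h.trans (List.prefix_append _ _))
    have h2 := hl (l ++ [s]) List.prefix_rfl (by simp)
    rw [List.length_append, List.length_singleton, killed, Finsupp.filter_apply_pos _ _ h2]
    simp only [List.map_append, List.map_cons, List.map_nil, List.prod_append,
      List.prod_singleton]
    exact (mul_le_mul_of_nonneg_right h1 (hm s)).trans (mul_le_conv (killed_nonneg hm _) hm _ _)

theorem prod_le_stopped (hm : 0 ≤ m) (l : List G) (s : G) {T : ℕ} (hT : l.length < T)
    (hl : ∀ l', l' <+: l → l' ≠ [] → D l'.prod) (hs : ¬ D (l ++ [s]).prod) :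
    ((l ++ [s]).map m).prod ≤ stopped m D T (l ++ [s]).prod := by
  classical
  have h0 : ((l ++ [s]).map m).prod ≤
      ((convolve (killed m D l.length) m).filter (fun g => ¬ D g)) (l ++ [s]).prod := by
    rw [Finsupp.filter_apply_pos (fun g => ¬ D g) _ hs]
    simp only [List.map_append, List.map_cons, List.map_nil, List.prod_append,
      List.prod_singleton]
    exact (mul_le_mul_of_nonneg_right (prod_le_killed hm l hl) (hm s)).trans
      (mul_le_conv (killed_nonneg hm _) hm _ _)
  refine h0.trans ?_
  rw [stopped, Finsupp.add_apply, Finsupp.finsetSum_apply]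
  refine le_add_of_le_of_nonneg ?_ (killed_nonneg hm T _)
  exact Finset.single_le_sum
    (f := fun t => ((convolve (killed m D t) m).filter (fun g => ¬ D g)) (l ++ [s]).prod)
    (fun t _ => filter_nonneg (conv_nonneg (killed_nonneg hm t) hm) (fun g => ¬ D g) _)
    (Finset.mem_range.2 hT)

end Walk

/-! ### Positive operators of finite trace are compact -/

section Compact

variable {H : Type*} [NormedAddCommGroup H] [InnerProductSpace ℂ H]

/-- `T * T ≤ ‖T‖ T` for a positive operator `T`. -/
theorem norm_apply_sq_le_of_isPositive {T : H →L[ℂ] H} (hT : T.IsPositive) (x : H) :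
    ‖T x‖ ^ 2 ≤ ‖T‖ * (⟪T x, x⟫_ℂ).re := by
  rcases (norm_nonneg T).eq_or_lt with h0 | h0
  · simp [norm_eq_zero.1 h0.symm]
  -- Expand the nonnegative number `⟪T y, y⟫` for `y = x - t T x` with `t = 1 / ‖T‖`.
  have h1 := hT.re_inner_nonneg_left (x - ((‖T‖⁻¹ : ℝ) : ℂ) • T x)
  have h2 : (⟪T (T x), T x⟫_ℂ).re ≤ ‖T‖ * ‖T x‖ ^ 2 := by
    refine (Complex.re_le_norm _).trans ((norm_inner_le_norm _ _).trans ?_)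
    nlinarith [T.le_opNorm (T x), norm_nonneg (T x)]
  have h3 : ⟪T (T x), x⟫_ℂ = ⟪T x, T x⟫_ℂ := hT.inner_left_eq_inner_right _ _
  have h4 : (⟪T x, T x⟫_ℂ).re = ‖T x‖ ^ 2 := by
    rw [inner_self_eq_norm_sq_to_K]; norm_cast
  simp only [map_sub, map_smul, inner_sub_left, inner_sub_right, inner_smul_left,
    inner_smul_right, h3, Complex.conj_ofReal] at h1
  simp only [RCLike.re_to_complex, Complex.sub_re, Complex.re_ofReal_mul, h4] at h1
  have h5 : ‖T‖⁻¹ * (‖T‖⁻¹ * (⟪T (T x), T x⟫_ℂ).re) ≤ ‖T‖⁻¹ * ‖T x‖ ^ 2 := by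
    refine mul_le_mul_of_nonneg_left ?_ (inv_nonneg.2 h0.le)
    rw [inv_mul_le_iff₀ h0]
    exact h2
  have h6 : ‖T‖⁻¹ * ‖T x‖ ^ 2 ≤ (⟪T x, x⟫_ℂ).re := by linarith
  rwa [inv_mul_le_iff₀ h0] at h6

theorem Orthonormal.fin_cons {k : ℕ} {e : Fin k → H} (he : Orthonormal ℂ e) {x : H}
    (hx : ‖x‖ = 1) (hxe : ∀ i, ⟪e i, x⟫_ℂ = 0) :
    Orthonormal ℂ (Fin.cons x e : Fin (k + 1) → H) := by
  refine ⟨fun i => ?_, fun i j hij => ?_⟩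
  · cases i using Fin.cases with
    | zero => simpa using hx
    | succ i => simpa using he.1 i
  · cases i using Fin.cases with
    | zero =>
      cases j using Fin.cases with
      | zero => exact absurd rfl hij
      | succ j => simpa using inner_eq_zero_symm.1 (hxe j)
    | succ i =>
      cases j using Fin.cases with
      | zero => simpa using hxe i
      | succ j => simpa using he.2 fun h => hij (by rw [h])

variable [CompleteSpace H]

/-- A positive operator whose trace is finite is compact: it is the norm limit of its compositions
with the projections onto finite-dimensional subspaces carrying almost all of the trace. -/
theorem isCompactOperator_of_trace_le {T : H →L[ℂ] H} (hT : T.IsPositive) (C : ℝ)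
    (hC : ∀ (k : ℕ) (e : Fin k → H), Orthonormal ℂ e → ∑ i, (⟪T (e i), e i⟫_ℂ).re ≤ C) :
    IsCompactOperator T := by
  set S : Set ℝ := {r | ∃ (k : ℕ) (e : Fin k → H), Orthonormal ℂ e ∧
    r = ∑ i, (⟪T (e i), e i⟫_ℂ).re} with hS
  have hSne : S.Nonempty := ⟨_, 0, Fin.elim0, ⟨fun i => i.elim0, fun i => i.elim0⟩, rfl⟩
  have hSb : BddAbove S := ⟨C, by rintro r ⟨k, e, he, rfl⟩; exact hC k e he⟩
  have hmem : T ∈ closure {f : H →L[ℂ] H | IsCompactOperator f} := by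
    rw [Metric.mem_closure_iff]
    intro δ hδ
    obtain ⟨ε, hε, hεδ⟩ : ∃ ε > 0, ‖T‖ * ε < δ ^ 2 / 4 := by
      refine ⟨δ ^ 2 / 4 / (‖T‖ + 1), by positivity, ?_⟩
      rw [mul_div_assoc', div_lt_iff₀ (by positivity), mul_comm]
      have : 0 < δ ^ 2 / 4 := by positivity
      nlinarith
    obtain ⟨r, ⟨k, e, he, rfl⟩, hr⟩ := exists_lt_of_lt_csSup hSne (sub_lt_self (sSup S) hε)
    set W : Submodule ℂ H := Submodule.span ℂ (Set.range e)
    have hWfin : FiniteDimensional ℂ W := FiniteDimensional.span_of_finite ℂ (Set.finite_range e)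
    have hunit : ∀ x : H, ‖x‖ = 1 → (∀ i, ⟪e i, x⟫_ℂ = 0) → (⟪T x, x⟫_ℂ).re ≤ ε := by
      intro x hx hxe
      have h := le_csSup hSb ⟨k + 1, _, he.fin_cons hx hxe, rfl⟩
      rw [Fin.sum_univ_succ] at h
      simp only [Fin.cons_zero, Fin.cons_succ] at h
      linarith
    have hperp : ∀ x ∈ Wᗮ, (⟪T x, x⟫_ℂ).re ≤ ε * ‖x‖ ^ 2 := by
      intro x hx
      by_cases hx0 : x = 0
      · simp [hx0]
      have hn : 0 < ‖x‖ := norm_pos_iff.2 hx0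
      have h := hunit (((‖x‖⁻¹ : ℝ) : ℂ) • x) (by
        rw [norm_smul, Complex.norm_real, Real.norm_of_nonneg (by positivity),
          inv_mul_cancel₀ hn.ne']) (fun i => by
        rw [inner_smul_right, (Submodule.mem_orthogonal W x).1 hx _
          (Submodule.subset_span ⟨i, rfl⟩), mul_zero])
      rw [map_smul, inner_smul_left, inner_smul_right, Complex.conj_ofReal,
        Complex.re_ofReal_mul, Complex.re_ofReal_mul, inv_mul_le_iff₀ hn,
        inv_mul_le_iff₀ hn] at h
      nlinarith
    have hcomp : IsCompactOperator (T ∘L W.starProjection) := by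
      have : T ∘L W.starProjection = (T ∘L W.subtypeL) ∘L W.orthogonalProjectionOnto := by
        ext x; simp
      rw [this]
      have h1 : IsCompactOperator (T ∘L W.subtypeL) :=
        isCompactOperator_of_locallyCompactSpace_rng (T ∘L W.subtypeL)
      exact h1.comp_clm _
    refine ⟨_, hcomp, ?_⟩
    rw [dist_eq_norm]
    refine lt_of_le_of_lt (ContinuousLinearMap.opNorm_le_bound _ (M := δ / 2) (by positivity)
      fun x => ?_) (half_lt_self hδ)
    have hx : (T - T ∘L W.starProjection) x = T (x - W.starProjection x) := by simp
    rw [hx]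
    have h1 : x - W.starProjection x ∈ Wᗮ := W.sub_starProjection_mem_orthogonal x
    have h2 : ‖x - W.starProjection x‖ ≤ ‖x‖ := by
      have := W.norm_sq_eq_add_norm_sq_starProjection x
      rw [Submodule.starProjection_orthogonal_val] at this
      refine abs_le_of_sq_le_sq' ?_ (norm_nonneg _) |>.2
      nlinarith [sq_nonneg ‖W.starProjection x‖]
    refine abs_le_of_sq_le_sq' ?_ (by positivity) |>.2
    have h3 := norm_apply_sq_le_of_isPositive hT (x - W.starProjection x)
    have h4 := mul_le_mul_of_nonneg_left (hperp _ h1) (norm_nonneg T)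
    have h5 : ‖x - W.starProjection x‖ ^ 2 ≤ ‖x‖ ^ 2 := by gcongr
    calc ‖T (x - W.starProjection x)‖ ^ 2
        ≤ ‖T‖ * ε * ‖x - W.starProjection x‖ ^ 2 := by linarith
      _ ≤ ‖T‖ * ε * ‖x‖ ^ 2 := by gcongr
      _ ≤ δ ^ 2 / 4 * ‖x‖ ^ 2 := by gcongr
      _ = (δ / 2 * ‖x‖) ^ 2 := by ring
  rwa [isClosed_setOfPred_isCompactOperator.closure_eq] at hmem

/-- The norm of a compact positive operator is an eigenvalue. -/
theorem hasEigenvalue_norm_of_isPositive {T : H →L[ℂ] H} (hT : T.IsPositive)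
    (hc : IsCompactOperator T) (h0 : T ≠ 0) :
    Module.End.HasEigenvalue (T : Module.End ℂ H) (‖T‖ : ℂ) := by
  have hn : 0 < ‖T‖ := norm_pos_iff.2 h0
  have : Nontrivial H := by
    by_contra h
    rw [not_nontrivial_iff_subsingleton] at h
    exact h0 (ContinuousLinearMap.ext fun x => Subsingleton.elim _ _)
  rw [hc.hasEigenvalue_iff_mem_spectrum (by exact_mod_cast hn.ne')]
  by_contra h
  obtain ⟨ε, hε, hle⟩ := T.rayleighQuotient_le_of_norm_mem_resolventSet (𝕜 := ℂ)
    (by simpa [spectrum] using h)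
  have h1 := T.norm_eq_iSup_rayleighQuotient hT.isSymmetric
  have h2 : ⨆ x, |T.rayleighQuotient x| ≤ ‖T‖ - ε := by
    refine ciSup_le fun x => ?_
    rw [abs_of_nonneg]
    · exact hle x
    · exact div_nonneg (hT.re_inner_nonneg_left x) (by positivity)
  linarith

end Compact

/-! ### Weak mixing and averages of matrix coefficients -/

section WeakMixing

variable {H : Type*} [NormedAddCommGroup H] [InnerProductSpace ℂ H] [CompleteSpace H]

/-- Bounded sequences of operators converge along ultrafilters in the weak operator topology. -/
theorem exists_weak_ultralimit {ι : Type*} (U : Ultrafilter ι) (A : ι → H →L[ℂ] H) (C : ℝ)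
    (hA : ∀ n, ‖A n‖ ≤ C) :
    ∃ Ψ : H →L[ℂ] H, ∀ x y, Tendsto (fun n => ⟪A n x, y⟫_ℂ) U (𝓝 ⟪Ψ x, y⟫_ℂ) := by
  have hbd : ∀ x y n, ‖⟪A n x, y⟫_ℂ‖ ≤ C * ‖x‖ * ‖y‖ := fun x y n =>
    (norm_inner_le_norm _ _).trans
      (mul_le_mul_of_nonneg_right ((A n).le_of_opNorm_le (hA n) x) (norm_nonneg y))
  have hlim : ∀ x y, ∃ z : ℂ, ‖z‖ ≤ C * ‖x‖ * ‖y‖ ∧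
      Tendsto (fun n => ⟪A n x, y⟫_ℂ) U (𝓝 z) := by
    intro x y
    obtain ⟨z, hz, hz'⟩ := (isCompact_closedBall (0 : ℂ) (C * ‖x‖ * ‖y‖)).ultrafilter_le_nhds
      (U.map fun n => ⟪A n x, y⟫_ℂ) (by
        rw [Ultrafilter.coe_map, le_principal_iff]
        exact Filter.mem_map.2 (Filter.univ_mem' fun n => by simpa using hbd x y n))
    exact ⟨z, by simpa using hz, hz'⟩
  choose B hB hBt using hlim
  let L : H →ₗ⋆[ℂ] H →ₗ[ℂ] ℂ := LinearMap.mk₂'ₛₗ (starRingEnd ℂ) (RingHom.id ℂ) B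
    (fun x x' y => tendsto_nhds_unique (hBt _ _) <| by
      simpa only [map_add, inner_add_left] using (hBt x y).add (hBt x' y))
    (fun r x y => tendsto_nhds_unique (hBt _ _) <| by
      simpa only [map_smul, inner_smul_left, smul_eq_mul] using (hBt x y).const_mul _)
    (fun x y y' => tendsto_nhds_unique (hBt _ _) <| by
      simpa only [inner_add_right] using (hBt x y).add (hBt x y'))
    (fun r x y => tendsto_nhds_unique (hBt _ _) <| by
      simpa only [inner_smul_right, smul_eq_mul, RingHom.id_apply] using (hBt x y).const_mul _)
  refine ⟨InnerProductSpace.continuousLinearMapOfBilin (L.mkContinuous₂ C hB), fun x y => ?_⟩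
  rw [InnerProductSpace.continuousLinearMapOfBilin_apply]
  exact hBt x y

/-- A subset of `H` preserved by a symmetric generating set is preserved by the whole group. -/
theorem map_mem_of_closure_eq_top {G : Type*} [Group G] {π : G →* unitary (H →L[ℂ] H)}
    {S : Set G} (hS : Subgroup.closure S = ⊤) (hinv : ∀ s ∈ S, s⁻¹ ∈ S) {V : Set H}
    (hV : ∀ s ∈ S, ∀ x ∈ V, (π s : H →L[ℂ] H) x ∈ V) (g : G) :
    ∀ x ∈ V, (π g : H →L[ℂ] H) x ∈ V := by
  have hg : g ∈ Subgroup.closure S := hS ▸ Subgroup.mem_top g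
  induction hg using Subgroup.closure_induction_left with
  | one => simp
  | mul_left s hs g _ ih =>
    intro x hx
    rw [map_mul]
    exact hV s hs _ (ih x hx)
  | inv_mul_cancel s hs g _ ih =>
    intro x hx
    rw [map_mul]
    exact hV _ (hinv s hs) _ (ih x hx)

variable {G : Type*} [Group G]

theorem inner_map_inv (π : G →* unitary (H →L[ℂ] H)) (g : G) (x y : H) :
    ⟪(π g⁻¹ : H →L[ℂ] H) x, y⟫_ℂ = ⟪x, (π g : H →L[ℂ] H) y⟫_ℂ := by
  rw [← Unitary.inner_map_map (π g), ← mul_apply_eq_comp, ← Submonoid.coe_mul,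
    ← map_mul]
  simp

/-- A positive compact operator on a weakly mixing representation that is harmonic for the
conjugation action vanishes: its top eigenspace is a finite-dimensional invariant subspace. -/
theorem eq_zero_of_harmonic {π : G →* unitary (H →L[ℂ] H)} (hπ : IsWeaklyMixingRep π)
    {m : G →₀ ℝ} (hm : 0 ≤ m) (hm1 : integ m (fun _ => (1 : ℝ)) = 1)
    (hgen : Subgroup.closure (m.support : Set G) = ⊤) (hsymm : ∀ g, m g⁻¹ = m g)
    {T : H →L[ℂ] H} (hT : T.IsPositive) (hc : IsCompactOperator T)
    (hharm : ∀ x, integ m (fun s => (⟪T ((π s : H →L[ℂ] H) x), (π s : H →L[ℂ] H) x⟫_ℂ).re) =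
      (⟪T x, x⟫_ℂ).re) : T = 0 := by
  by_contra h0
  have hev := hasEigenvalue_norm_of_isPositive hT hc h0
  have hn : 0 < ‖T‖ := norm_pos_iff.2 h0
  have hn' : (‖T‖ : ℂ) ≠ 0 := by exact_mod_cast hn.ne'
  have hfin := ContinuousLinearMap.finite_dimensional_eigenspace hc _ hn'
  have hle : ∀ x, (⟪T x, x⟫_ℂ).re ≤ ‖T‖ * ‖x‖ ^ 2 := fun x => by
    refine (Complex.re_le_norm _).trans ((norm_inner_le_norm _ _).trans ?_)
    nlinarith [T.le_opNorm x, norm_nonneg x]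
  have hiff : ∀ x, T x = (‖T‖ : ℂ) • x ↔ (⟪T x, x⟫_ℂ).re = ‖T‖ * ‖x‖ ^ 2 := by
    intro x
    constructor
    · intro h
      rw [h, inner_smul_left, Complex.conj_ofReal, Complex.re_ofReal_mul,
        inner_self_eq_norm_sq_to_K]
      norm_cast
    · intro h
      rw [← sub_eq_zero, ← norm_eq_zero, ← sq_eq_zero_iff]
      refine le_antisymm ?_ (sq_nonneg _)
      rw [@norm_sub_sq ℂ, inner_smul_right, RCLike.re_to_complex, Complex.re_ofReal_mul, h,
        norm_smul, Complex.norm_real, norm_norm]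
      have := norm_apply_sq_le_of_isPositive hT x
      rw [h] at this
      nlinarith
  refine hev (hπ _ hfin fun g v hv => ?_)
  refine map_mem_of_closure_eq_top (π := π) hgen
    (fun s hs => by simpa [hsymm] using hs) (V := Module.End.eigenspace T.toLinearMap ‖T‖)
    (fun s hs x hx => ?_) g v hv
  simp only [SetLike.mem_coe, Module.End.mem_eigenspace_iff, ContinuousLinearMap.coe_coe]
    at hx ⊢
  rw [hiff] at hx ⊢
  rw [Unitary.norm_map]
  -- The integrand is at most `‖T‖ * ‖x‖ ^ 2`, which is also its mean.
  by_contra hne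
  have hlt : 0 < m s * (‖T‖ * ‖x‖ ^ 2 -
      (⟪T ((π s : H →L[ℂ] H) x), (π s : H →L[ℂ] H) x⟫_ℂ).re) := by
    refine mul_pos ((hm s).lt_of_ne' (Finsupp.mem_support_iff.1 hs)) ?_
    have := hle ((π s : H →L[ℂ] H) x)
    rw [Unitary.norm_map] at this
    exact sub_pos.2 (this.lt_of_ne hne)
  have h1 := mul_le_integ hm (f := fun s => ‖T‖ * ‖x‖ ^ 2 -
      (⟪T ((π s : H →L[ℂ] H) x), (π s : H →L[ℂ] H) x⟫_ℂ).re) (fun s _ => by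
    have := hle ((π s : H →L[ℂ] H) x)
    rw [Unitary.norm_map] at this
    exact sub_nonneg.2 this) s
  rw [integ_sub, hharm, integ_const hm1, hx, sub_self] at h1
  exact absurd hlt (not_lt.2 h1)

/-- If the measures `a n` are almost invariant under convolution with `m`, relative to the
normalisation `c n`, then squared matrix coefficients of a weakly mixing representation have
vanishing averages. -/
theorem tendsto_integ_norm_inner_sq {π : G →* unitary (H →L[ℂ] H)} (hπ : IsWeaklyMixingRep π)
    {m : G →₀ ℝ} (hm : 0 ≤ m) (hm1 : integ m (fun _ => (1 : ℝ)) = 1)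
    (hgen : Subgroup.closure (m.support : Set G) = ⊤) (hsymm : ∀ g, m g⁻¹ = m g)
    {a e : ℕ → G →₀ ℝ} {c : ℕ → ℝ} (ha : ∀ n, 0 ≤ a n) (he : ∀ n, 0 ≤ e n)
    (he1 : ∀ n, integ (e n) (fun _ => (1 : ℝ)) = 1) (hc : ∀ n, 0 < c n)
    (hct : Tendsto c atTop atTop) (hac : ∀ n, integ (a n) (fun _ => (1 : ℝ)) ≤ c n)
    (hae : ∀ n, convolve (a n) m + Finsupp.single 1 1 = a n + e n) (u v : H) :
    Tendsto (fun n => (c n)⁻¹ * integ (a n) (fun g => ‖⟪v, (π g : H →L[ℂ] H) u⟫_ℂ‖ ^ 2))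
      atTop (𝓝 0) := by
  rw [tendsto_iff_ultrafilter]
  intro U hU
  set w : G → H := fun g => (π g⁻¹ : H →L[ℂ] H) v with hw
  -- The limit `Ψ` of the averaged conjugates of the rank one operator defined by `v`.
  set A : ℕ → H →L[ℂ] H := fun n =>
    (c n)⁻¹ • integ (a n) (fun g => InnerProductSpace.rankOne ℂ (w g) (w g)) with hA
  have hre : ∀ n x, (⟪A n x, x⟫_ℂ).re =
      (c n)⁻¹ * integ (a n) (fun g => ‖⟪v, (π g : H →L[ℂ] H) x⟫_ℂ‖ ^ 2) := by
    intro n x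
    let L : (H →L[ℂ] H) →ₗ[ℝ] ℝ :=
      { toFun := fun T => (⟪T x, x⟫_ℂ).re
        map_add' := fun T T' => by simp
        map_smul' := fun r T => by
          rw [smul_apply, ← Complex.coe_smul, inner_smul_left,
            Complex.conj_ofReal, Complex.re_ofReal_mul]
          rfl }
    change L (A n) = _
    rw [hA, map_smul, ← integ_map, smul_eq_mul]
    congr 2
    funext g
    change (⟪InnerProductSpace.rankOne ℂ (w g) (w g) x, x⟫_ℂ).re = _
    rw [InnerProductSpace.rankOne_apply, inner_smul_left, hw, inner_map_inv, mul_comm,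
      Complex.mul_conj, Complex.normSq_eq_norm_sq, Complex.ofReal_re]
  have him : ∀ n x, (⟪A n x, x⟫_ℂ).im = 0 := by
    intro n x
    let L : (H →L[ℂ] H) →ₗ[ℝ] ℝ :=
      { toFun := fun T => (⟪T x, x⟫_ℂ).im
        map_add' := fun T T' => by simp
        map_smul' := fun r T => by
          rw [smul_apply, ← Complex.coe_smul, inner_smul_left,
            Complex.conj_ofReal, Complex.im_ofReal_mul]
          rfl }
    change L (A n) = _
    rw [hA, map_smul, ← integ_map]
    have : ∀ g, L (InnerProductSpace.rankOne ℂ (w g) (w g)) = 0 := by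
      intro g
      change (⟪InnerProductSpace.rankOne ℂ (w g) (w g) x, x⟫_ℂ).im = _
      rw [InnerProductSpace.rankOne_apply, inner_smul_left, mul_comm,
        Complex.mul_conj, Complex.ofReal_im]
    simp [this, integ_eq_sum]
  have hbd : ∀ n, ‖A n‖ ≤ ‖v‖ ^ 2 := by
    intro n
    have h := norm_integ_le (ha n) (f := fun g => InnerProductSpace.rankOne ℂ (w g) (w g))
      (C := ‖v‖ ^ 2) fun g => by
        rw [InnerProductSpace.norm_rankOne, hw, Unitary.norm_map, sq]
    rw [hA, norm_smul, norm_inv, Real.norm_of_nonneg (hc n).le, inv_mul_le_iff₀ (hc n), mul_comm]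
    exact h.trans (mul_le_mul_of_nonneg_left (hac n) (by positivity))
  obtain ⟨Ψ, hΨ⟩ := exists_weak_ultralimit U A _ hbd
  have hΨre : ∀ x, Tendsto (fun n => (⟪A n x, x⟫_ℂ).re) U (𝓝 (⟪Ψ x, x⟫_ℂ).re) := fun x =>
    (Complex.continuous_re.tendsto _).comp (hΨ x x)
  have hpos : Ψ.IsPositive := by
    rw [ContinuousLinearMap.isPositive_iff_complex]
    intro x
    have h1 : (⟪Ψ x, x⟫_ℂ).im = 0 := by
      refine tendsto_nhds_unique ((Complex.continuous_im.tendsto _).comp (hΨ x x)) ?_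
      simp only [Function.comp_def, him]
      exact tendsto_const_nhds
    refine ⟨Complex.ext rfl ?_, ge_of_tendsto' (hΨre x) fun n => ?_⟩
    · rw [h1]; rfl
    · rw [hre]
      exact mul_nonneg (inv_nonneg.2 (hc n).le) (integ_nonneg (ha n) fun g _ => sq_nonneg _)
  have hcomp : IsCompactOperator Ψ := by
    refine isCompactOperator_of_trace_le hpos (‖v‖ ^ 2) fun k f hf => ?_
    refine le_of_tendsto' (tendsto_finsetSum _ fun i _ => hΨre (f i)) fun n => ?_
    simp only [hre]
    rw [← Finset.mul_sum, ← integ_finset_sum, inv_mul_le_iff₀ (hc n), mul_comm]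
    refine le_trans ?_ (mul_le_mul_of_nonneg_left (hac n) (sq_nonneg ‖v‖))
    rw [← integ_const_mul]
    refine integ_mono (ha n) fun g _ => ?_
    -- Bessel's inequality for `π g⁻¹ v`.
    have h := hf.sum_inner_products_le (w g) (s := Finset.univ)
    rw [hw, Unitary.norm_map] at h
    rw [mul_one]
    refine le_of_eq_of_le (Finset.sum_congr rfl fun i _ => ?_) h
    rw [← inner_map_inv, norm_inner_symm]
  have hzero : Ψ = 0 := by
    refine eq_zero_of_harmonic hπ hm hm1 hgen hsymm hpos hcomp fun x => ?_
    have h1 : Tendsto (fun n => integ m fun s =>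
        (⟪A n ((π s : H →L[ℂ] H) x), (π s : H →L[ℂ] H) x⟫_ℂ).re) U
        (𝓝 (integ m fun s => (⟪Ψ ((π s : H →L[ℂ] H) x), (π s : H →L[ℂ] H) x⟫_ℂ).re)) := by
      simp only [integ_eq_sum]
      exact tendsto_finsetSum _ fun s _ => (hΨre _).const_smul _
    have h2 := h1.sub (hΨre x)
    rw [← sub_eq_zero]
    refine tendsto_nhds_unique h2 (squeeze_zero_norm (a := fun n =>
      (c n)⁻¹ * (2 * (‖v‖ * ‖x‖) ^ 2)) (fun n => ?_) ?_)
    · set f : G → ℝ := fun g => ‖⟪v, (π g : H →L[ℂ] H) x⟫_ℂ‖ ^ 2 with hf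
      have hf0 : ∀ g, 0 ≤ f g := fun g => sq_nonneg _
      have hf1 : ∀ g, f g ≤ (‖v‖ * ‖x‖) ^ 2 := fun g => by
        have h := norm_inner_le_norm (𝕜 := ℂ) v ((π g : H →L[ℂ] H) x)
        rw [Unitary.norm_map] at h
        exact pow_le_pow_left₀ (norm_nonneg _) h 2
      have h3 := congrArg (fun p => integ p f) (hae n)
      simp only [integ_add_left, integ_conv, integ_single, one_smul] at h3
      have h4 : (integ m fun s =>
          (⟪A n ((π s : H →L[ℂ] H) x), (π s : H →L[ℂ] H) x⟫_ℂ).re) =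
          (c n)⁻¹ * integ (a n) (fun g => integ m fun s => f (g * s)) := by
        simp only [hre, integ_const_mul]
        congr 1
        simp only [hf, map_mul, integ_eq_sum, Finset.smul_sum]
        rw [Finset.sum_comm]
        refine Finset.sum_congr rfl fun g _ => Finset.sum_congr rfl fun s _ => ?_
        simp only [smul_eq_mul, Submonoid.coe_mul, mul_apply_eq_comp]
        ring
      rw [h4, hre, ← mul_sub, norm_mul, norm_inv, Real.norm_of_nonneg (hc n).le]
      refine mul_le_mul_of_nonneg_left ?_ (inv_nonneg.2 (hc n).le)
      have h5 : |integ (e n) f| ≤ (‖v‖ * ‖x‖) ^ 2 := by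
        have := norm_integ_le (he n) (f := f) (C := (‖v‖ * ‖x‖) ^ 2) fun g => by
          rw [Real.norm_of_nonneg (hf0 g)]; exact hf1 g
        rwa [he1, mul_one] at this
      have h6 : integ (a n) (fun g => integ m fun s => f (g * s)) - integ (a n) f =
          integ (e n) f - f 1 := by linarith
      rw [Real.norm_eq_abs, h6, abs_le]
      rw [abs_le] at h5
      constructor <;> linarith [hf0 1, hf1 1]
    · have := (tendsto_inv_atTop_zero.comp (hct.mono_left hU)).mul_const (2 * (‖v‖ * ‖x‖) ^ 2)
      rwa [zero_mul] at this
  have h := hΨre u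
  simp only [hre, hzero] at h
  simpa using h

end WeakMixing

/-! ### The walk in a strip around level zero -/

section Strip

variable {G : Type*} [Group G]

/-- The elements at nonzero level of absolute value less than `n`. -/
def strip (k : G → ℤ) (n : ℕ) (g : G) : Prop := k g ≠ 0 ∧ |k g| < n

variable {m : G →₀ ℝ} {k : G → ℤ}

theorem level_one (hk : ∀ g h, k (g * h) = k g + k h) : k 1 = 0 := by
  simpa using hk 1 1

theorem abs_level_lt_of_killed_ne_zero (hk : ∀ g h, k (g * h) = k g + k h) {n : ℕ} (hn : 0 < n)
    {t : ℕ} {g : G} (h : killed m (strip k n) t g ≠ 0) : |k g| < n := by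
  cases t with
  | zero =>
    have : g = 1 := by
      by_contra hg
      exact h (Finsupp.single_eq_of_ne hg)
    rw [this, level_one hk]
    simpa using hn
  | succ t => exact (mem_of_killed_succ_ne_zero h).2

theorem abs_level_le_of_stopped_ne_zero (hk : ∀ g h, k (g * h) = k g + k h)
    (hstep : ∀ s, m s ≠ 0 → k s = 1 ∨ k s = -1) {n : ℕ} (hn : 0 < n) {T : ℕ} {g : G}
    (h : stopped m (strip k n) T g ≠ 0) : |k g| ≤ n := by
  classical
  by_contra hlt
  refine h ?_
  rw [stopped, Finsupp.add_apply, Finsupp.finsetSum_apply, Finset.sum_eq_zero, zero_add]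
  · by_contra h'
    exact hlt (abs_level_lt_of_killed_ne_zero hk hn h').le
  · intro t _
    by_contra h'
    have h2 : convolve (killed m (strip k n) t) m g ≠ 0 := fun h0 => h' (by
      rw [Finsupp.filter_apply, h0, ite_self])
    obtain ⟨x, s, hx, hs, rfl⟩ := exists_of_conv_ne_zero h2
    have h3 := abs_level_lt_of_killed_ne_zero hk hn hx
    apply hlt
    rw [hk, abs_le]
    rw [abs_lt] at h3
    rcases hstep s hs with h4 | h4 <;> omega

/-- The expected absolute level of the stopped walk is at most `1`: the first step brings it to `1`,
and from then until the return to level zero the absolute value of the level is a martingale. -/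
theorem integ_stopped_abs_le (hk : ∀ g h, k (g * h) = k g + k h)
    (hstep : ∀ s, m s ≠ 0 → k s = 1 ∨ k s = -1)
    (hm1 : integ m (fun _ => (1 : ℝ)) = 1) (hmean : integ m (fun s => (k s : ℝ)) = 0)
    (n T : ℕ) : integ (stopped m (strip k n) T) (fun g => |(k g : ℝ)|) ≤ 1 := by
  have hL : ∀ g, integ m (fun s => |(k (g * s) : ℝ)|) - |(k g : ℝ)| =
      if k g = 0 then 1 else 0 := by
    intro g
    rcases lt_trichotomy (k g) 0 with h | h | h
    · have h1 : integ m (fun s => |(k (g * s) : ℝ)|) = integ m (fun s => -(k g : ℝ) - k s) := by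
        refine integ_congr fun s hs => ?_
        have : k (g * s) ≤ 0 := by rw [hk]; rcases hstep s hs with h | h <;> omega
        rw [abs_of_nonpos (by exact_mod_cast this), hk]
        push_cast; ring
      rw [h1, integ_sub, integ_const hm1, hmean, if_neg h.ne,
        abs_of_neg (by exact_mod_cast h)]
      ring
    · have h1 : integ m (fun s => |(k (g * s) : ℝ)|) = integ m (fun _ => (1 : ℝ)) := by
        refine integ_congr fun s hs => ?_
        rw [hk, h]
        rcases hstep s hs with h | h <;> simp [h]
      rw [h1, hm1, if_pos h, h]
      simp
    · have h1 : integ m (fun s => |(k (g * s) : ℝ)|) = integ m (fun s => (k g : ℝ) + k s) := by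
        refine integ_congr fun s hs => ?_
        have : 0 ≤ k (g * s) := by rw [hk]; rcases hstep s hs with h | h <;> omega
        rw [abs_of_nonneg (by exact_mod_cast this), hk]
        push_cast; ring
      rw [h1, integ_add, integ_const hm1, hmean, if_neg h.ne',
        abs_of_pos (by exact_mod_cast h)]
      ring
  rw [integ_stopped]
  simp only [hL, level_one hk]
  rw [Int.cast_zero, abs_zero, zero_add, green, integ_sum_left]
  cases T with
  | zero => simp
  | succ T =>
    rw [Finset.sum_range_succ', Finset.sum_eq_zero]
    · rw [killed, integ_single]
      split_ifs <;> simp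
    · intro t _
      rw [integ_congr (f' := fun _ => (0 : ℝ)), integ_const_zero]
      intro g hg
      exact if_neg (mem_of_killed_succ_ne_zero hg).1

theorem integ_green_one_le (hk : ∀ g h, k (g * h) = k g + k h)
    (hstep : ∀ s, m s ≠ 0 → k s = 1 ∨ k s = -1) (hm : 0 ≤ m)
    (hm1 : integ m (fun _ => (1 : ℝ)) = 1) (hmean : integ m (fun s => (k s : ℝ)) = 0)
    {n : ℕ} (hn : 0 < n) (T : ℕ) :
    integ (green m (strip k n) T) (fun _ => (1 : ℝ)) ≤ n := by
  -- The square of the level increases by `1` on average at each step.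
  have hL : ∀ g, integ m (fun s => (k (g * s) : ℝ) ^ 2) - (k g : ℝ) ^ 2 = 1 := by
    intro g
    have h1 : integ m (fun s => (k (g * s) : ℝ) ^ 2) =
        integ m (fun s => ((k g : ℝ) ^ 2 + 1) + 2 * k g * k s) := by
      refine integ_congr fun s hs => ?_
      rw [hk]
      rcases hstep s hs with h | h <;> rw [h] <;> push_cast <;> ring
    rw [h1, integ_add, integ_const hm1, integ_const_mul, hmean]
    ring
  have h1 := integ_stopped (m := m) (D := strip k n) T (fun g => (k g : ℝ) ^ 2)
  simp only [hL, level_one hk] at h1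
  rw [Int.cast_zero, zero_pow two_ne_zero, zero_add] at h1
  rw [← h1]
  have h2 : integ (stopped m (strip k n) T) (fun g => (k g : ℝ) ^ 2) ≤
      integ (stopped m (strip k n) T) (fun g => (n : ℝ) * |(k g : ℝ)|) := by
    refine integ_mono (stopped_nonneg hm T) fun g hg => ?_
    have h : |(k g : ℝ)| ≤ n := by
      exact_mod_cast abs_level_le_of_stopped_ne_zero hk hstep hn hg
    rw [← sq_abs, sq]
    exact mul_le_mul_of_nonneg_right h (abs_nonneg _)
  rw [integ_const_mul] at h2
  refine h2.trans ?_
  have := integ_stopped_abs_le hk hstep hm1 hmean n T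
  nlinarith [(Nat.cast_nonneg n : (0 : ℝ) ≤ n)]

theorem integ_stopped_strip_le (hm : 0 ≤ m) {D : G → Prop} [DecidablePred D] (T : ℕ) :
    integ (stopped m D T) (fun g => if D g then (1 : ℝ) else 0) ≤
      integ (killed m D T) (fun _ => (1 : ℝ)) := by
  classical
  rw [stopped, integ_add_left, integ_sum_left, Finset.sum_eq_zero, zero_add]
  · exact integ_mono (killed_nonneg hm T) fun g _ => by split_ifs <;> simp
  · intro t _
    rw [integ_filter, integ_congr (f' := fun _ => (0 : ℝ)), integ_const_zero]
    intro g _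
    by_cases h : D g <;> simp [h]

/-- Up to time `n ^ 2` the walk has returned to level zero before leaving the strip, except with
probability of order `1 / n`. -/
theorem integ_stopped_level_ne_zero_le (hk : ∀ g h, k (g * h) = k g + k h)
    (hstep : ∀ s, m s ≠ 0 → k s = 1 ∨ k s = -1) (hm : 0 ≤ m)
    (hm1 : integ m (fun _ => (1 : ℝ)) = 1) (hmean : integ m (fun s => (k s : ℝ)) = 0)
    {n : ℕ} (hn : 0 < n) :
    integ (stopped m (strip k n) (n ^ 2)) (fun g => if k g = 0 then (0 : ℝ) else 1) ≤ 2 / n := by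
  classical
  have hn' : (0 : ℝ) < n := by exact_mod_cast hn
  have h1 : integ (stopped m (strip k n) (n ^ 2)) (fun g => if k g = 0 then (0 : ℝ) else 1) ≤
      integ (stopped m (strip k n) (n ^ 2))
        (fun g => (n : ℝ)⁻¹ * |(k g : ℝ)| + if strip k n g then (1 : ℝ) else 0) := by
    refine integ_mono (stopped_nonneg hm _) fun g _ => ?_
    have h0 : 0 ≤ (n : ℝ)⁻¹ * |(k g : ℝ)| := by positivity
    by_cases hg : k g = 0
    · rw [if_pos hg]
      split_ifs <;> linarith
    · rw [if_neg hg]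
      by_cases hs : strip k n g
      · rw [if_pos hs]; linarith
      · rw [if_neg hs, add_zero, le_inv_mul_iff₀ hn', mul_one]
        have : (n : ℤ) ≤ |k g| := by
          by_contra h
          exact hs ⟨hg, not_le.1 h⟩
        exact_mod_cast this
  rw [integ_add, integ_const_mul] at h1
  have h2 := integ_stopped_abs_le hk hstep hm1 hmean n (n ^ 2)
  have h3 := integ_stopped_strip_le hm (D := strip k n) (n ^ 2)
  have h4 := (mul_integ_killed_le hm hm1 (D := strip k n) (n ^ 2)).trans
    (integ_green_one_le hk hstep hm hm1 hmean hn (n ^ 2))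
  have h5 : integ (killed m (strip k n) (n ^ 2)) (fun _ => (1 : ℝ)) ≤ (n : ℝ)⁻¹ := by
    rw [← one_div, le_div_iff₀ hn']
    push_cast at h4
    nlinarith
  have h6 := mul_le_mul_of_nonneg_left h2 (inv_nonneg.2 hn'.le)
  rw [div_eq_mul_inv]
  linarith

/-- A harmonic function that is nonnegative on level zero, vanishes at `1` and has sublinear
energy vanishes at the endpoints of the paths whose first return to level zero is at the end. -/
theorem harmonic_eq_zero_of_first_return (hk : ∀ g h, k (g * h) = k g + k h)
    (hstep : ∀ s, m s ≠ 0 → k s = 1 ∨ k s = -1) (hm : 0 ≤ m)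
    (hm1 : integ m (fun _ => (1 : ℝ)) = 1) (hmean : integ m (fun s => (k s : ℝ)) = 0)
    {h : G → ℝ} (h1 : h 1 = 0) (hharm : ∀ g, integ m (fun s => h (g * s)) = h g)
    (hnonneg : ∀ g, k g = 0 → 0 ≤ h g)
    (henergy : Tendsto (fun n : ℕ => ((n + 1 : ℕ) : ℝ)⁻¹ *
      integ (green m (strip k (n + 1)) ((n + 1) ^ 2))
        (fun g => integ m fun s => (h (g * s) - h g) ^ 2)) atTop (𝓝 0))
    {l : List G} {s : G} (hl : ∀ x ∈ l ++ [s], m x ≠ 0)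
    (hret : ∀ l', l' <+: l → l' ≠ [] → k l'.prod ≠ 0) (hend : k (l ++ [s]).prod = 0) :
    h (l ++ [s]).prod = 0 := by
  set p : ℝ := ((l ++ [s]).map m).prod with hp
  have hp0 : 0 < p := by
    rw [hp]
    refine List.prod_pos fun x hx => ?_
    obtain ⟨y, hy, rfl⟩ := List.mem_map.1 hx
    exact (hm y).lt_of_ne' (hl y hy)
  -- The level of a product of steps is bounded by the number of steps.
  have hlen : ∀ l' : List G, (∀ x ∈ l', m x ≠ 0) → |k l'.prod| ≤ l'.length := by
    intro l'
    induction l' with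
    | nil => intro _; simp [level_one hk]
    | cons x l' ih =>
      intro hx
      have h2 := ih fun y hy => hx y (List.mem_cons_of_mem _ hy)
      rw [List.prod_cons, hk, List.length_cons]
      rw [abs_le] at h2 ⊢
      push_cast
      rcases hstep x (hx x List.mem_cons_self) with h3 | h3 <;> constructor <;> omega
  have hbound : ∀ n : ℕ, l.length ≤ n → (p * h (l ++ [s]).prod) ^ 2 ≤ 2 * (((n + 1 : ℕ) : ℝ)⁻¹ *
      integ (green m (strip k (n + 1)) ((n + 1) ^ 2))
        (fun g => integ m fun s => (h (g * s) - h g) ^ 2)) := by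
    intro n hn
    set D := strip k (n + 1)
    set T := (n + 1) ^ 2
    have hE : 0 ≤ stopped m D T := stopped_nonneg hm T
    -- The contribution of level zero to the expectation of `h`, which is zero in total.
    have e1 : p * h (l ++ [s]).prod ≤
        integ (stopped m D T) (fun g => if k g = 0 then h g else 0) := by
      have hlow : p ≤ stopped m D T (l ++ [s]).prod := by
        refine prod_le_stopped hm l s (by simp only [T]; nlinarith)
          (fun l' hl' hne => ⟨hret l' hl' hne, ?_⟩) fun hD => hD.1 hend
        have h2 := hlen l' fun x hx => hl x (List.mem_append_left _ (hl'.subset hx))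
        have h3 := hl'.length_le
        push_cast
        omega
      refine (mul_le_mul_of_nonneg_right hlow (hnonneg _ hend)).trans ?_
      have := mul_le_integ hE (f := fun g => if k g = 0 then h g else 0)
        (fun g _ => by split_ifs with h0; exacts [hnonneg g h0, le_rfl]) (l ++ [s]).prod
      rwa [if_pos hend] at this
    have e2 : integ (stopped m D T) (fun g => if k g = 0 then h g else 0) +
        integ (stopped m D T) (fun g => h g * if k g = 0 then 0 else 1) = 0 := by
      rw [← integ_add]
      have : (fun g => (if k g = 0 then h g else 0) + h g * if k g = 0 then 0 else 1) = h := by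
        funext g; split_ifs <;> simp
      rw [this, integ_stopped, h1]
      simp [hharm, integ_const_zero]
    have e3 := integ_mul_sq_le hE h (fun g => if k g = 0 then 0 else 1)
    have e4 : integ (stopped m D T) (fun g => h g ^ 2) =
        integ (green m D T) (fun g => integ m fun s => (h (g * s) - h g) ^ 2) := by
      rw [integ_stopped, h1]
      simp only [ne_eq, OfNat.ofNat_ne_zero, not_false_eq_true, zero_pow, zero_add]
      congr 1
      funext g
      have : (fun s => (h (g * s) - h g) ^ 2) =
          fun s => h (g * s) ^ 2 - (2 * h g * h (g * s) - h g ^ 2) := by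
        funext s; ring
      rw [this, integ_sub, integ_sub, integ_const_mul, hharm, integ_const hm1]
      ring
    have e5 := integ_stopped_level_ne_zero_le hk hstep hm hm1 hmean (Nat.succ_pos n)
    have e6 : integ (stopped m D T) (fun g => (if k g = 0 then (0 : ℝ) else 1) ^ 2) ≤
        2 / (n + 1 : ℕ) := by
      refine le_trans (le_of_eq ?_) e5
      congr 1
      funext g; split_ifs <;> simp
    have e7 : (p * h (l ++ [s]).prod) ^ 2 ≤
        integ (stopped m D T) (fun g => h g * if k g = 0 then 0 else 1) ^ 2 := by
      rw [← neg_sq (integ _ _), ← eq_neg_of_add_eq_zero_left e2]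
      exact pow_le_pow_left₀ (mul_nonneg hp0.le (hnonneg _ hend)) e1 2
    refine e7.trans (e3.trans ?_)
    rw [← e4]
    calc _ ≤ integ (stopped m D T) (fun g => h g ^ 2) * (2 / (n + 1 : ℕ)) :=
          mul_le_mul_of_nonneg_left e6 (integ_nonneg hE fun g _ => sq_nonneg _)
      _ = _ := by ring
  have hlim := henergy.const_mul 2
  rw [mul_zero] at hlim
  have h2 : (p * h (l ++ [s]).prod) ^ 2 ≤ 0 :=
    ge_of_tendsto hlim (eventually_atTop.2 ⟨l.length, hbound⟩)
  have h3 := sq_eq_zero_iff.1 (le_antisymm h2 (sq_nonneg _))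
  exact (mul_eq_zero.1 h3).resolve_left hp0.ne'

/-- Every word at level zero is a product of words returning to level zero only at their end. -/
theorem of_first_returns (hk : ∀ g h, k (g * h) = k g + k h) {S : Set G} {P : G → Prop}
    (hP1 : P 1) (hPmul : ∀ g h, P g → P h → P (g * h))
    (hPret : ∀ (l : List G) (s : G), (∀ x ∈ l ++ [s], x ∈ S) →
      (∀ l', l' <+: l → l' ≠ [] → k l'.prod ≠ 0) → k (l ++ [s]).prod = 0 → P (l ++ [s]).prod)
    (l : List G) (hl : ∀ x ∈ l, x ∈ S) (h0 : k l.prod = 0) : P l.prod := by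
  induction hn : l.length using Nat.strong_induction_on generalizing l with
  | _ n ih =>
    rcases l.eq_nil_or_concat' with rfl | ⟨l, s, rfl⟩
    · simpa using hP1
    by_cases h : ∀ l', l' <+: l → l' ≠ [] → k l'.prod ≠ 0
    · exact hPret l s hl h h0
    · push Not at h
      obtain ⟨q, ⟨r, rfl⟩, hq, hkq⟩ := h
      have hql : 0 < q.length := List.length_pos_iff.2 hq
      simp only [List.length_append, List.length_singleton] at hn
      rw [List.append_assoc, List.prod_append] at h0 ⊢
      rw [hk, hkq, zero_add] at h0
      refine hPmul _ _ (ih _ (by omega) q (fun x hx => hl x (by simp [hx])) hkq rfl)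
        (ih (r ++ [s]).length ?_ _ (fun x hx => hl x ?_) h0 rfl)
      · simp only [List.length_append, List.length_singleton]; omega
      · rw [List.append_assoc]; exact List.mem_append_right _ hx

end Strip

/-! ### The cocycle on a finite normal subgroup of the kernel -/

section Cocycle

variable {G N H : Type*} [Group G] [Group N] [NormedAddCommGroup H] [InnerProductSpace ℂ H]
  [CompleteSpace H]

theorem IsOneCocycle.map_one {π : G →* unitary (H →L[ℂ] H)} {b : G → H} (hb : IsOneCocycle π b) :
    b 1 = 0 := by
  simpa using hb 1 1

/-- On a finite normal subgroup `F` of `N` the cocycle is the coboundary of its mean `ξ`. On all of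
`N` its inner product with `ξ` is that of the coboundary of `ξ`: the difference of the two cocycles
takes values in the `F`-invariant vectors, to which `ξ` is orthogonal. -/
theorem exists_coboundary_vector (ι : N →* G) (F : Subgroup N) (hFnormal : F.Normal)
    (hFfinite : Finite F) {π : G →* unitary (H →L[ℂ] H)} {b : G → H} (hb : IsOneCocycle π b) :
    ∃ ξ : H, (∀ γ ∈ F, b (ι γ) = ξ - (π (ι γ) : H →L[ℂ] H) ξ) ∧
      ∀ n : N, ⟪ξ, b (ι n)⟫_ℂ = ⟪ξ, ξ⟫_ℂ - ⟪ξ, (π (ι n) : H →L[ℂ] H) ξ⟫_ℂ := by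
  have : Fintype F := Fintype.ofFinite F
  set c : ℂ := (Fintype.card F : ℂ) with hc
  have hc0 : c ≠ 0 := by rw [hc]; exact_mod_cast Fintype.card_ne_zero
  set S : H := ∑ γ : F, b (ι γ) with hS
  set ξ : H := c⁻¹ • S with hξ
  have hcξ : c • ξ = S := by rw [hξ, smul_smul, mul_inv_cancel₀ hc0, one_smul]
  have hcard : ∀ x : H, ∑ _γ : F, x = c • x := fun x => by
    rw [Finset.sum_const, Finset.card_univ, hc, Nat.cast_smul_eq_nsmul]
  have hF : ∀ γ : F, b (ι γ) = ξ - (π (ι γ) : H →L[ℂ] H) ξ := by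
    intro γ
    have h1 : S = ∑ γ' : F, b (ι ((γ * γ' : F) : N)) :=
      (Equiv.sum_comp (Equiv.mulLeft γ) fun γ' : F => b (ι γ')).symm
    simp only [Subgroup.coe_mul, map_mul, hb _ _] at h1
    rw [Finset.sum_add_distrib, hcard, ← map_sum, ← hS, ← hcξ, map_smul, ← smul_add] at h1
    exact eq_sub_of_add_eq (smul_right_injective H hc0 h1).symm
  have hsum : ∑ γ : F, (π (ι γ) : H →L[ℂ] H) ξ = 0 := by
    have h1 : S = ∑ γ : F, (ξ - (π (ι γ) : H →L[ℂ] H) ξ) := Finset.sum_congr rfl fun γ _ => hF γ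
    rw [Finset.sum_sub_distrib, hcard, hcξ] at h1
    exact sub_eq_self.1 h1.symm
  refine ⟨ξ, fun γ hγ => hF ⟨γ, hγ⟩, fun n => ?_⟩
  -- Sum the two cocycle expansions of `b (γ * n) = b (n * (n⁻¹ * γ * n))` over `γ`.
  have h1 : S + ∑ γ : F, (π (ι γ) : H →L[ℂ] H) (b (ι n)) =
      c • b (ι n) + (π (ι n) : H →L[ℂ] H) S := by
    have h2 : S = ∑ γ : F, b (ι ((MulAut.conjNormal n⁻¹ γ : F) : N)) :=
      (Equiv.sum_comp (MulAut.conjNormal n⁻¹ : MulAut F).toEquiv fun γ : F => b (ι γ)).symm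
    conv_rhs => rw [h2, map_sum, ← hcard, ← Finset.sum_add_distrib]
    rw [hS, ← Finset.sum_add_distrib]
    refine Finset.sum_congr rfl fun γ _ => ?_
    rw [← hb, ← hb, ← map_mul, ← map_mul, MulAut.conjNormal_apply]
    congr 2
    group
  have h2 : ⟪ξ, ∑ γ : F, (π (ι γ) : H →L[ℂ] H) (b (ι n))⟫_ℂ = 0 := by
    rw [inner_sum, ← Equiv.sum_comp (Equiv.inv F)]
    simp only [Equiv.inv_apply, Subgroup.coe_inv, map_inv]
    have h3 : ∀ γ : F, ⟪ξ, ((π (ι γ))⁻¹ : unitary (H →L[ℂ] H)).1 (b (ι n))⟫_ℂ =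
        ⟪(π (ι γ) : H →L[ℂ] H) ξ, b (ι n)⟫_ℂ := fun γ => by
      rw [← map_inv, ← inner_map_inv, inv_inv]
    rw [Finset.sum_congr rfl fun γ _ => h3 γ, ← sum_inner, hsum, inner_zero_left]
  have h3 := congrArg (fun x => ⟪ξ, x⟫_ℂ) h1
  simp only [inner_add_right, h2, ← hcξ, map_smul, inner_smul_right, add_zero] at h3
  rw [← mul_add] at h3
  rw [mul_left_cancel₀ hc0 h3]
  ring

end Cocycle

/-! ### The step law as a finitely supported measure -/

section StepLaw

variable {G : Type*}

/-- A mass function of finite support, as a finitely supported real measure. -/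
noncomputable def PMF.toFinsupp (μ : PMF G) (h : μ.support.Finite) : G →₀ ℝ :=
  Finsupp.ofSupportFinite (fun g => (μ g).toReal) (h.subset fun g hg => by
    rw [PMF.mem_support_iff]
    rintro h0
    exact hg (by simp [h0]))

variable {μ : PMF G} {h : μ.support.Finite}

theorem PMF.toFinsupp_apply (g : G) : μ.toFinsupp h g = (μ g).toReal := rfl

theorem PMF.toFinsupp_ne_zero_iff {g : G} : μ.toFinsupp h g ≠ 0 ↔ g ∈ μ.support := by
  rw [PMF.toFinsupp_apply, PMF.mem_support_iff, ENNReal.toReal_ne_zero]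
  exact and_iff_left (μ.apply_ne_top g)

theorem PMF.toFinsupp_nonneg : 0 ≤ μ.toFinsupp h := fun _ => ENNReal.toReal_nonneg

theorem PMF.hasSum_integ_toFinsupp {E : Type*} [NormedAddCommGroup E] [NormedSpace ℝ E]
    (f : G → E) : HasSum (fun g => (μ g).toReal • f g) (integ (μ.toFinsupp h) f) :=
  hasSum_sum_of_ne_finset_zero fun g hg => by
    rw [← PMF.toFinsupp_apply (h := h), Finsupp.notMem_support_iff.1 hg, zero_smul]

theorem PMF.integ_toFinsupp_one : integ (μ.toFinsupp h) (fun _ => (1 : ℝ)) = 1 := by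
  refine (PMF.hasSum_integ_toFinsupp (h := h) fun _ => (1 : ℝ)).unique ?_
  have h1 := ENNReal.hasSum_toReal (f := μ) (by rw [μ.tsum_coe]; exact ENNReal.one_ne_top)
  rw [← ENNReal.tsum_toReal_eq μ.apply_ne_top, μ.tsum_coe] at h1
  simpa using h1

theorem integ_eq_zero_of_odd [Group G] {m : G →₀ ℝ} (hsymm : ∀ g, m g⁻¹ = m g) {f : G → ℝ}
    (hf : ∀ g, f g⁻¹ = -f g) : integ m f = 0 := by
  have h1 : integ m f = -integ m f := by
    rw [integ_eq_sum, ← Finset.sum_neg_distrib]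
    refine Finset.sum_nbij' (fun g => g⁻¹) (fun g => g⁻¹) ?_ ?_ ?_ ?_ ?_ <;>
      simp [hsymm, hf]
  linarith

end StepLaw

theorem proposition3p1 {G N H : Type*} [Group G] [Group.FG G] [Group N]
    [NormedAddCommGroup H] [InnerProductSpace ℂ H] [CompleteSpace H]
    -- the exact sequence `1 → N → G → ℤ → 1`
    (ι : N →* G) (φ : G →* Multiplicative ℤ)
    (hι : Function.Injective ι) (hexact : ι.range = φ.ker) (hφ : Function.Surjective φ)
    (F : Subgroup N) (hFnormal : F.Normal) (hFfinite : Finite F)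
    (μ : PMF G) (hsymm : IsSymmetricLaw μ) (hsupp : HasFiniteGeneratingSupport μ)
    (hproj : μ.map (fun g => (φ g).toAdd) = simpleRandomWalkLaw)
    (π : G →* unitary (H →L[ℂ] H)) (hπ : IsWeaklyMixingRep π)
    (b : G → H) (hb : IsOneCocycle π b) (hharm : IsHarmonicFor μ b) :
    ∀ γ ∈ F, b (ι γ) = 0 := by
  obtain ⟨ξ, hξF, hξN⟩ := exists_coboundary_vector ι F hFnormal hFfinite hb
  obtain ⟨hfin, hgen⟩ := hsupp
  set m : G →₀ ℝ := μ.toFinsupp hfin with hm_def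
  have hm : 0 ≤ m := PMF.toFinsupp_nonneg
  have hm1 : integ m (fun _ => (1 : ℝ)) = 1 := PMF.integ_toFinsupp_one
  have hmsupp : (m.support : Set G) = μ.support := by
    ext g
    rw [Finset.mem_coe, Finsupp.mem_support_iff, hm_def, PMF.toFinsupp_ne_zero_iff]
  have hmgen : Subgroup.closure (m.support : Set G) = ⊤ := by rw [hmsupp, hgen]
  have hmsymm : ∀ g, m g⁻¹ = m g := fun g => by
    rw [hm_def, PMF.toFinsupp_apply, PMF.toFinsupp_apply, hsymm g]
  set k : G → ℤ := fun g => (φ g).toAdd with hk_def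
  have hk : ∀ g h, k (g * h) = k g + k h := fun g h => by simp [hk_def]
  have hstep : ∀ s, m s ≠ 0 → k s = 1 ∨ k s = -1 := by
    intro s hs
    have h1 : k s ∈ (μ.map k).support :=
      (PMF.mem_support_map_iff _ _ _).2 ⟨s, PMF.toFinsupp_ne_zero_iff.1 hs, rfl⟩
    rw [hproj, simpleRandomWalkLaw, PMF.support_uniformOfFinset] at h1
    simpa using h1
  have hmean : integ m (fun s => (k s : ℝ)) = 0 :=
    integ_eq_zero_of_odd hmsymm fun g => by simp [hk_def]
  have hrange : ∀ g, k g = 0 → ∃ n, ι n = g := fun g hg => by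
    have h1 : g ∈ ι.range := by
      rw [hexact, MonoidHom.mem_ker]
      exact Multiplicative.toAdd.injective hg
    exact h1
  -- The harmonic function `h`, which on `N` is half the squared displacement of `ξ`.
  set h : G → ℝ := fun g => (⟪ξ, b g⟫_ℂ).re with hh
  have hN : ∀ g, k g = 0 → ‖ξ - (π g : H →L[ℂ] H) ξ‖ ^ 2 = 2 * h g := by
    intro g hg
    obtain ⟨n, rfl⟩ := hrange g hg
    have hself : (⟪ξ, ξ⟫_ℂ).re = ‖ξ‖ ^ 2 := inner_self_eq_norm_sq (𝕜 := ℂ) ξ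
    rw [hh, @norm_sub_sq ℂ, Unitary.norm_map]
    simp only [hξN, Complex.sub_re, RCLike.re_to_complex, hself]
    ring
  have hh1 : h 1 = 0 := by simp [hh, hb.map_one]
  have hhharm : ∀ g, integ m (fun s => h (g * s)) = h g := by
    intro g
    have h1 : integ m (fun s => b (g * s)) = b g := by
      refine (PMF.hasSum_integ_toFinsupp (h := hfin) fun s => b (g * s)).unique ?_
      simpa only [Complex.coe_smul] using hharm g
    let L : H →ₗ[ℝ] ℝ := (Complex.reCLM ∘L (innerSL ℂ ξ).restrictScalars ℝ).toLinearMap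
    have h2 := integ_map L m (fun s => b (g * s))
    rw [h1] at h2
    exact h2
  have hhdiff : ∀ g s, (h (g * s) - h g) ^ 2 ≤ ‖⟪ξ, (π g : H →L[ℂ] H) (b s)⟫_ℂ‖ ^ 2 := by
    intro g s
    have h1 : h (g * s) - h g = (⟪ξ, (π g : H →L[ℂ] H) (b s)⟫_ℂ).re := by
      simp [hh, hb g s]
    rw [h1, ← sq_abs]
    exact pow_le_pow_left₀ (abs_nonneg _) (Complex.abs_re_le_norm _) 2
  have henergy : Tendsto (fun n : ℕ => ((n + 1 : ℕ) : ℝ)⁻¹ *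
      integ (green m (strip k (n + 1)) ((n + 1) ^ 2))
        (fun g => integ m fun s => (h (g * s) - h g) ^ 2)) atTop (𝓝 0) := by
    have hmix : ∀ s, Tendsto (fun n : ℕ => ((n + 1 : ℕ) : ℝ)⁻¹ *
        integ (green m (strip k (n + 1)) ((n + 1) ^ 2))
          (fun g => ‖⟪ξ, (π g : H →L[ℂ] H) (b s)⟫_ℂ‖ ^ 2)) atTop (𝓝 0) := fun s =>
      tendsto_integ_norm_inner_sq hπ hm hm1 hmgen hmsymm (fun n => green_nonneg hm _)
        (fun n => stopped_nonneg hm _) (fun n => integ_stopped_one hm1 _)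
        (fun n => Nat.cast_pos.2 n.succ_pos)
        (tendsto_natCast_atTop_atTop.comp (tendsto_add_atTop_nat 1))
        (fun n => integ_green_one_le hk hstep hm hm1 hmean n.succ_pos _)
        (fun n => conv_green _) (b s) ξ
    have hsum := tendsto_finsetSum m.support fun s _ => (hmix s).const_mul (m s)
    simp only [mul_zero, Finset.sum_const_zero] at hsum
    refine squeeze_zero (fun n => ?_) (fun n => ?_) hsum
    · exact mul_nonneg (by positivity) (integ_nonneg (green_nonneg hm _) fun g _ =>
        integ_nonneg hm fun s _ => sq_nonneg _)
    · have h1 : integ (green m (strip k (n + 1)) ((n + 1) ^ 2))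
          (fun g => integ m fun s => (h (g * s) - h g) ^ 2) ≤
          integ (green m (strip k (n + 1)) ((n + 1) ^ 2))
          (fun g => integ m fun s => ‖⟪ξ, (π g : H →L[ℂ] H) (b s)⟫_ℂ‖ ^ 2) :=
        integ_mono (green_nonneg hm _) fun g _ => integ_mono hm fun s _ => hhdiff g s
      refine (mul_le_mul_of_nonneg_left h1 (by positivity)).trans (le_of_eq ?_)
      simp only [integ_eq_sum m, smul_eq_mul]
      rw [integ_finset_sum, Finset.mul_sum]
      refine Finset.sum_congr rfl fun s _ => ?_
      rw [integ_const_mul]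
      ring
  have hfix : ∀ l : List G, (∀ x ∈ l, x ∈ μ.support) → k l.prod = 0 →
      (π l.prod : H →L[ℂ] H) ξ = ξ := by
    refine of_first_returns hk (P := fun g => (π g : H →L[ℂ] H) ξ = ξ) (by simp) ?_ ?_
    · intro g g' hg hg'
      rw [map_mul, Submonoid.coe_mul, mul_apply_eq_comp, hg', hg]
    · intro l s hl hret hend
      have h1 := harmonic_eq_zero_of_first_return hk hstep hm hm1 hmean hh1 hhharm
        (fun g hg => by have := hN g hg; nlinarith [sq_nonneg ‖ξ - (π g : H →L[ℂ] H) ξ‖])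
        henergy (fun x hx => PMF.toFinsupp_ne_zero_iff.2 (hl x hx)) hret hend
      have h2 := hN _ hend
      rw [h1, mul_zero, sq_eq_zero_iff, norm_eq_zero, sub_eq_zero] at h2
      exact h2.symm
  intro γ hγ
  have hmem : ι γ ∈ Submonoid.closure μ.support := by
    have h1 : μ.support⁻¹ ⊆ μ.support := fun g hg => by
      rw [Set.mem_inv, PMF.mem_support_iff, hsymm g] at hg
      exact (PMF.mem_support_iff _ _).2 hg
    have h2 := Subgroup.closure_toSubmonoid μ.support
    rw [Set.union_eq_self_of_subset_right h1, hgen] at h2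
    rw [← h2]
    trivial
  obtain ⟨l, hl, hprod⟩ := Submonoid.exists_list_of_mem_closure hmem
  have hker : k (ι γ) = 0 := by
    have h1 : ι γ ∈ φ.ker := hexact ▸ ⟨γ, rfl⟩
    simp [hk_def, MonoidHom.mem_ker.1 h1]
  have h1 := hfix l hl (by rw [hprod, hker])
  rw [hprod] at h1
  rw [hξF γ hγ, h1, sub_self]
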